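/- Let $n\ge 3$. Consider the Pauli matrices $$\sigma_x=\begin{pmatrix}0&1\\1&0\end{pmatrix},\qquad \sigma_y=\begin{pmatrix}0&i\\-i&0\end{pmatrix},\qquad \sigma_z=\begin{pmatrix}1&0\\0&-1\end{pmatrix},$$ and for a $2\times 2$ matrix $\sigma$ let $\sigma^j$ be the $n$-fold tensor product with $\sigma$ in position $j$ and the $2\times2$ identity ${\bf 1}$ in all other positions. Let $$H_0=\sum_{j=1}^{n-1}\sigma_z^j\sigma_z^{j+1}+\sigma_z^n\sigma_z^1,\qquad H_1=\sum_{j=1}^n\sigma_x^j,$$ and let $\mathcal L$ (the dynamical Lie algebra of the periodic Ising chain) be the real Lie algebra of $2^n\times 2^n$ complex matrices, with the commutator as bracket, generated by $iH_0$ and $iH_1$. For a $2^n\times 2^n$ matrix $A$ let $\mathcal C(A)=\sum_{P}PAP^{T}$, the sum being over the $n$ permutation matrices $P$ of the cyclic translations of the $n$ tensor factors. For $j=0,1,\dots,n-2$ define $$\mathbf Y^j=i\,\mathcal C(\sigma_y\otimes\sigma_x^{\otimes j}\otimes\sigma_y\otimes{\bf 1}^{\otimes(n-j-2)}),\qquad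 \mathbf Z^j=i\,\mathcal C(\sigma_z\otimes\sigma_x^{\otimes j}\otimes\sigma_z\otimes{\bf 1}^{\otimes(n-j-2)}),$$ $$\mathbf{YZ}^j=i\,\mathcal C(\sigma_z\otimes\sigma_x^{\otimes j}\otimes\sigma_y\otimes{\bf 1}^{\otimes(n-j-2)})+i\,\mathcal C(\sigma_y\otimes\sigma_x^{\otimes j}\otimes\sigma_z\otimes{\bf 1}^{\otimes(n-j-2)}),$$ and $$\mathbf X=i\,\mathcal C(\sigma_x\otimes{\bf 1}^{\otimes(n-1)}),\qquad \mathbf{XX}=i\,\mathcal C(\sigma_x^{\otimes(n-1)}\otimes{\bf 1}).$$ Let the polynomials $a_k=a_k(\lambda)$ be defined by $a_{-1}=0$, $a_0=1$ and $a_k=\lambda a_{k-1}-a_{k-2}$ for $k\ge1$. Let $\bar\lambda$ be a real root of $a_{n-1}$. Then the real linear span of the three elements $$\hat X_{\bar\lambda}=a_0(\mathbf X+\mathbf Z^1)+a_{n-2}(\bar\lambda)(\mathbf{XX}-\mathbf Y^{n-3})+\sum_{k=1}^{n-3}a_k(\bar\lambda)(\mathbf Z^{k+1}-\mathbf Y^{k-1}),$$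 $$\hat Y_{\bar\lambda}=\sum_{k=0}^{n-2}a_k(\bar\lambda)(\mathbf Y^k-\mathbf Z^k),\qquad \hat Z_{\bar\lambda}=\sum_{k=0}^{n-2}a_k(\bar\lambda)\,\mathbf{YZ}^k$$ is an ideal of the Lie algebra $\mathcal L$ (in particular, it is contained in $\mathcal L$). -/

import Mathlib

attribute [local instance 100] LieRing.ofAssociativeRing

noncomputable section

namespace IsingChain

/-- Operators on `(ℂ²)^{⊗ n}`, as matrices whose rows and columns are indexed by the standard
product basis, i.e. by the functions `Fin n → Fin 2`.  With the commutator bracket these form a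
Lie algebra over `ℝ`. -/
abbrev Op (n : ℕ) : Type := Matrix (Fin n → Fin 2) (Fin n → Fin 2) ℂ

/-- The Pauli matrix `σ_x`. -/
def pauliX : Matrix (Fin 2) (Fin 2) ℂ := !![0, 1; 1, 0]

/-- The Pauli matrix `σ_y`, with the sign for which `[i σ_x, i σ_y] = 2 i σ_z`. -/
def pauliY : Matrix (Fin 2) (Fin 2) ℂ := !![0, Complex.I; -Complex.I, 0]

/-- The Pauli matrix `σ_z`. -/
def pauliZ : Matrix (Fin 2) (Fin 2) ℂ := !![1, 0; 0, -1]

/-- The tensor (Kronecker) product `M 0 ⊗ M 1 ⊗ ⋯ ⊗ M (n-1)` of `2 × 2` matrices. -/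
def tensor {n : ℕ} (M : Fin n → Matrix (Fin 2) (Fin 2) ℂ) : Op n :=
  Matrix.of fun s t => ∏ p, M p (s p) (t p)

/-- The tensor product of `n` identities, except for `M` in position `j`. -/
def site {n : ℕ} (M : Matrix (Fin 2) (Fin 2) ℂ) (j : Fin n) : Op n :=
  tensor (Function.update (fun _ => 1) j M)

/-- `H₀ = ∑_j σ_z^j σ_z^{j+1}`, the position `j + 1` being taken cyclically. -/
def H0 (n : ℕ) : Op n := ∑ j : Fin n, site pauliZ j * site pauliZ (finRotate n j)

/-- `H₁ = ∑_j σ_x^j`. -/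
def H1 (n : ℕ) : Op n := ∑ j : Fin n, site pauliX j

/-- The dynamical Lie algebra: the real Lie algebra generated by `i H₀` and `i H₁`. -/
def dynamicalLieAlgebra (n : ℕ) : LieSubalgebra ℝ (Op n) :=
  LieSubalgebra.lieSpan ℝ (Op n) {Complex.I • H0 n, Complex.I • H1 n}

/-- The permutation matrix of the one-step cyclic translation of the `n` tensor factors. -/
def shift (n : ℕ) : Op n :=
  Equiv.Perm.permMatrix ℂ ((finRotate n).arrowCongr (Equiv.refl (Fin 2)))

/-- The symmetrization `𝒞(A) = ∑_P P A Pᵀ`, the sum being over the cyclic group `C_n` of the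
translations of the `n` tensor factors, i.e. over the powers `P = shift ^ k`, `0 ≤ k < n`. -/
def symmetrize {n : ℕ} (A : Op n) : Op n :=
  ∑ k ∈ Finset.range n, shift n ^ k * A * (shift n ^ k).transpose

/-- `M ⊗ σ_x^{⊗ j} ⊗ N ⊗ 1^{⊗ (n-j-2)}`, meaningful for `j ≤ n - 2`. -/
def stringOp (n j : ℕ) (M N : Matrix (Fin 2) (Fin 2) ℂ) : Op n :=
  tensor fun p =>
    if (p : ℕ) = 0 then M
    else if (p : ℕ) ≤ j then pauliX
    else if (p : ℕ) = j + 1 then N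
    else 1

/-- `𝐘^j = i 𝒞(σ_y ⊗ σ_x^{⊗ j} ⊗ σ_y ⊗ 1^{⊗ (n-j-2)})`, for `j = 0, …, n - 2`. -/
def opY (n j : ℕ) : Op n := Complex.I • symmetrize (stringOp n j pauliY pauliY)

/-- `𝐙^j = i 𝒞(σ_z ⊗ σ_x^{⊗ j} ⊗ σ_z ⊗ 1^{⊗ (n-j-2)})`, for `j = 0, …, n - 2`. -/
def opZ (n j : ℕ) : Op n := Complex.I • symmetrize (stringOp n j pauliZ pauliZ)

/-- `𝐘𝐙^j = i 𝒞(σ_z ⊗ σ_x^{⊗ j} ⊗ σ_y ⊗ 1^{⊗ (n-j-2)}) + i 𝒞(σ_y ⊗ σ_x^{⊗ j} ⊗ σ_z ⊗ 1^{⊗ (n-j-2)})`,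
for `j = 0, …, n - 2`. -/
def opYZ (n j : ℕ) : Op n :=
  Complex.I • symmetrize (stringOp n j pauliZ pauliY) +
    Complex.I • symmetrize (stringOp n j pauliY pauliZ)

/-- `𝐗 = i 𝒞(σ_x ⊗ 1^{⊗ (n-1)})`. -/
def opX (n : ℕ) : Op n :=
  Complex.I • symmetrize (tensor fun p => if (p : ℕ) = 0 then pauliX else 1)

/-- `𝐗𝐗 = i 𝒞(σ_x^{⊗ (n-1)} ⊗ 1)`. -/
def opXX (n : ℕ) : Op n :=
  Complex.I • symmetrize (tensor fun p => if (p : ℕ) < n - 1 then pauliX else 1)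

/-- The polynomials `a_k`: `a_0 = 1` and `a_k = λ a_{k-1} - a_{k-2}` for `k ≥ 1`, where
`a_{-1} = 0`; thus `a_1 = λ`. -/
def a : ℕ → Polynomial ℝ
  | 0 => 1
  | 1 => Polynomial.X
  | k + 2 => Polynomial.X * a (k + 1) - a k

/-- `X̂_l = a_0 (𝐗 + 𝐙^1) + a_{n-2}(l) (𝐗𝐗 - 𝐘^{n-3}) + ∑_{k=1}^{n-3} a_k(l) (𝐙^{k+1} - 𝐘^{k-1})`,
for `n ≥ 3`. -/
def hatX (n : ℕ) (l : ℝ) : Op n :=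
  (a 0).eval l • (opX n + opZ n 1) + (a (n - 2)).eval l • (opXX n - opY n (n - 3)) +
    ∑ k ∈ Finset.Icc 1 (n - 3), (a k).eval l • (opZ n (k + 1) - opY n (k - 1))

/-- `Ŷ_l = ∑_{k=0}^{n-2} a_k(l) (𝐘^k - 𝐙^k)`. -/
def hatY (n : ℕ) (l : ℝ) : Op n :=
  ∑ k ∈ Finset.Icc 0 (n - 2), (a k).eval l • (opY n k - opZ n k)

/-- `Ẑ_l = ∑_{k=0}^{n-2} a_k(l) 𝐘𝐙^k`. -/
def hatZ (n : ℕ) (l : ℝ) : Op n :=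
  ∑ k ∈ Finset.Icc 0 (n - 2), (a k).eval l • opYZ n k

end IsingChain

end

/-! The operators `σ_x^p` and `σ_z^p σ_z^{p+1}` alternate around a ring of `2n` bonds. Each bond
squares to `1`, anticommutes with its two neighbours and commutes with the other bonds. `H₁` is the
sum of the even bonds and `H₀` of the odd ones. Up to a unit scalar, a Pauli string `M ⊗ σ_x ⊗ ⋯ ⊗
σ_x ⊗ N` is a product of consecutive bonds, and `𝒞` sums it over its translates.

In the bracket of such a product with `H₀` or `H₁` the interior contributions cancel. What remains
is the string lengthened or shortened by one bond at an end (`lie_consecProd_odd`,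
`lie_consecProd_even`). Summed over translations, this gives the relations `IsingRelations` between
three sequences `Y`, `Z`, `T`. The ends of `T` vanish: `T 0` trivially, and `T` at the number of
sites because the product of all bonds does not depend on where it starts (`consecProd_bond_full`).

The brackets of the generators with the three hatted elements then either reproduce one of them or
yield a sum of `a_k (T (k+2) + T k)`. The recurrence and the condition `a_{n-1}(l) = 0` say that
`(a_k(l))` is an eigenvector, with eigenvalue `l`, of the adjacency matrix of a path, so this sum is
`l` times the third element (`sum_a_mul_shift`). Hence the span is stable under both generators, and
by Jacobi under the whole algebra. -/

namespace IsingChain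

/-! ### Products of consecutive bonds and their commutators -/

section Bond

variable {R : Type*} [Ring R]

/-- The product `h i * h (i + 1) * ⋯ * h (i + m - 1)` of `m` consecutive terms of a sequence. -/
def consecProd (h : ℕ → R) (i : ℕ) : ℕ → R
  | 0 => 1
  | m + 1 => consecProd h i m * h (i + m)

variable {h : ℕ → R}

@[simp] lemma consecProd_zero (i : ℕ) : consecProd h i 0 = 1 := rfl

lemma consecProd_succ (i m : ℕ) :
    consecProd h i (m + 1) = consecProd h i m * h (i + m) := rfl

@[simp] lemma consecProd_one (i : ℕ) : consecProd h i 1 = h i := by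
  simp [consecProd_succ]

lemma consecProd_succ' (i m : ℕ) :
    consecProd h i (m + 1) = h i * consecProd h (i + 1) m := by
  induction m with
  | zero => simp
  | succ m ih =>
    rw [consecProd_succ, ih, consecProd_succ, mul_assoc, show i + 1 + m = i + (m + 1) by ring]

lemma consecProd_congr {g : ℕ → R} (i j m : ℕ) (hg : ∀ k, g (i + k) = h (j + k)) :
    consecProd g i m = consecProd h j m := by
  induction m with
  | zero => rfl
  | succ m ih => rw [consecProd_succ, consecProd_succ, ih, hg]

lemma Commute.consecProd_right {b : R} (i m : ℕ) (hb : ∀ k < m, Commute b (h (i + k))) :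
    Commute b (consecProd h i m) := by
  induction m with
  | zero => exact Commute.one_right b
  | succ m ih =>
    exact (ih fun k hk => hb k (by omega)).mul_right (hb m (by omega))

variable {C : R}

/-- Commutator of `C` with the products of consecutive terms starting at an odd offset, when `C`
commutes with the terms at even offsets. -/
lemma lie_consecProd_odd (hsq : ∀ i, h i * h i = 1) {i : ℕ}
    (h0 : ∀ q, ⁅C, h (i + 2 * q)⁆ = 0)
    (h1 : ∀ q, ⁅C, h (i + 2 * q + 1)⁆ =
      2 * (h (i + 2 * q) * h (i + 2 * q + 1)) - 2 * (h (i + 2 * q + 1) * h (i + 2 * q + 2)))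
    (m : ℕ) :
    ⁅C, consecProd h (i + 1) (2 * m + 1)⁆ =
        2 * consecProd h i (2 * m + 2) - 2 * consecProd h (i + 1) (2 * m + 2) ∧
      ⁅C, consecProd h (i + 1) (2 * m + 2)⁆ =
        2 * consecProd h i (2 * m + 3) - 2 * consecProd h (i + 1) (2 * m + 1) := by
  have step : ∀ m, ⁅C, consecProd h (i + 1) (2 * m + 1)⁆ =
        2 * consecProd h i (2 * m + 2) - 2 * consecProd h (i + 1) (2 * m + 2) →
      ⁅C, consecProd h (i + 1) (2 * m + 2)⁆ =
        2 * consecProd h i (2 * m + 3) - 2 * consecProd h (i + 1) (2 * m + 1) := by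
    intro m hm
    have e := h0 (m + 1)
    have s := hsq (i + 2 * (m + 1))
    rw [consecProd_succ i (2 * m + 2)]
    rw [consecProd_succ (i + 1) (2 * m + 1)] at hm ⊢
    rw [show i + 1 + (2 * m + 1) = i + 2 * (m + 1) by ring] at hm ⊢
    rw [show i + (2 * m + 2) = i + 2 * (m + 1) by ring]
    rw [Ring.lie_def] at e hm ⊢
    linear_combination (norm := noncomm_ring) hm * h (i + 2 * (m + 1)) +
      consecProd h (i + 1) (2 * m + 1) * e - 2 * consecProd h (i + 1) (2 * m + 1) * s
  suffices H : ⁅C, consecProd h (i + 1) (2 * m + 1)⁆ =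
        2 * consecProd h i (2 * m + 2) - 2 * consecProd h (i + 1) (2 * m + 2) from
    ⟨H, step m H⟩
  induction m with
  | zero => simpa [consecProd_succ, mul_assoc] using h1 0
  | succ m ih =>
    have e := step m ih
    have f := h1 (m + 1)
    rw [show 2 * (m + 1) = 2 * m + 2 by ring] at f ⊢
    rw [consecProd_succ i (2 * m + 2 + 1), consecProd_succ (i + 1) (2 * m + 2 + 1)]
    rw [consecProd_succ (i + 1) (2 * m + 2)]
    rw [show i + 1 + (2 * m + 2) = i + (2 * m + 2) + 1 by ring,
      show i + (2 * m + 2 + 1) = i + (2 * m + 2) + 1 by ring,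
      show i + 1 + (2 * m + 2 + 1) = i + (2 * m + 2) + 2 by ring]
    have g : consecProd h (i + 1) (2 * m + 2) =
      consecProd h (i + 1) (2 * m + 1) * h (i + (2 * m + 2)) := by
      rw [consecProd_succ (i + 1) (2 * m + 1)]; congr 2; ring
    have s := hsq (i + (2 * m + 2))
    -- The last bond of the old string squares away. The right-end term of the old bracket therefore
    -- cancels the left term contributed by the new bond.
    have g' : consecProd h (i + 1) (2 * m + 2) * h (i + (2 * m + 2)) =
      consecProd h (i + 1) (2 * m + 1) := by rw [g, mul_assoc, s, mul_one]
    rw [Ring.lie_def] at e f ⊢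
    linear_combination (norm := noncomm_ring) e * h (i + (2 * m + 2) + 1) +
      consecProd h (i + 1) (2 * m + 2) * f + 2 * g' * h (i + (2 * m + 2) + 1)

/-- Commutator of `C` with the products of consecutive terms starting at an even offset, when `C`
commutes with the terms at even offsets. -/
lemma lie_consecProd_even (hsq : ∀ i, h i * h i = 1) {i : ℕ}
    (h0 : ∀ q, ⁅C, h (i + 2 * q)⁆ = 0)
    (h1 : ∀ q, ⁅C, h (i + 2 * q + 1)⁆ =
      2 * (h (i + 2 * q) * h (i + 2 * q + 1)) - 2 * (h (i + 2 * q + 1) * h (i + 2 * q + 2)))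
    (m : ℕ) :
    ⁅C, consecProd h i (2 * m + 1)⁆ =
        2 * consecProd h (i + 1) (2 * m) - 2 * consecProd h i (2 * m) ∧
      ⁅C, consecProd h i (2 * m + 2)⁆ =
        2 * consecProd h (i + 1) (2 * m + 1) - 2 * consecProd h i (2 * m + 3) := by
  have e : ⁅C, h i⁆ = 0 := by simpa using h0 0
  have s := hsq i
  -- The first bond commutes with `C` and factors out, which reduces everything to the odd case.
  have key : ∀ k, ⁅C, consecProd h i (k + 1)⁆ = h i * ⁅C, consecProd h (i + 1) k⁆ := by
    intro k
    rw [consecProd_succ']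
    rw [Ring.lie_def] at e ⊢
    rw [Ring.lie_def]
    linear_combination (norm := noncomm_ring) e * consecProd h (i + 1) k
  have canc : ∀ k, h i * consecProd h i (k + 1) = consecProd h (i + 1) k := by
    intro k
    rw [consecProd_succ', ← mul_assoc, s, one_mul]
  constructor
  · cases m with
    | zero => simpa using e
    | succ m =>
      rw [show 2 * (m + 1) = 2 * m + 1 + 1 by ring, key, (lie_consecProd_odd hsq h0 h1 m).2,
        consecProd_succ' i (2 * m + 1), ← canc (2 * m + 1 + 1)]
      noncomm_ring
  · rw [show 2 * m + 2 = 2 * m + 1 + 1 by ring, key, (lie_consecProd_odd hsq h0 h1 m).1,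
      consecProd_succ' i (2 * m + 2), ← canc (2 * m + 1)]
    noncomm_ring

/-- The sum of the products of `m` consecutive terms over one period of length `2 * n`, taken over
the starting points congruent to `c` modulo `2`. -/
def consecSum (h : ℕ → R) (n c m : ℕ) : R :=
  ∑ p ∈ Finset.range n, consecProd h (c + 2 * p) m

lemma consecProd_add_period {n : ℕ} (hper : ∀ i, h (i + 2 * n) = h i) (i m : ℕ) :
    consecProd h (i + 2 * n) m = consecProd h i m :=
  consecProd_congr _ _ _ fun k => by rw [← hper (i + k)]; congr 1; ring

lemma sum_range_succ_of_periodic {n : ℕ} {f : ℕ → R} (hf : f n = f 0) :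
    ∑ p ∈ Finset.range n, f (p + 1) = ∑ p ∈ Finset.range n, f p := by
  have h1 := Finset.sum_range_succ f n
  have h2 := Finset.sum_range_succ' f n
  rw [h1, hf] at h2
  exact (add_right_cancel h2).symm

/-- Needed because brackets with `H₀` use `c = 1` and so produce the offset `c + 1 = 2`. -/
lemma consecSum_two {n : ℕ} (hper : ∀ i, h (i + 2 * n) = h i) (m : ℕ) :
    consecSum h n 2 m = consecSum h n 0 m := by
  unfold consecSum
  rw [← sum_range_succ_of_periodic (f := fun p => consecProd h (0 + 2 * p) m)]
  · refine Finset.sum_congr rfl fun p _ => ?_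
    congr 1; ring
  · simpa using consecProd_add_period hper 0 m

section

variable {n c : ℕ} (hsq : ∀ i, h i * h i = 1)
  (h0 : ∀ q, ⁅C, h (c + 2 * q)⁆ = 0)
  (h1 : ∀ q, ⁅C, h (c + 2 * q + 1)⁆ =
    2 * (h (c + 2 * q) * h (c + 2 * q + 1)) - 2 * (h (c + 2 * q + 1) * h (c + 2 * q + 2)))
include hsq h0 h1

lemma lie_consecSum (m : ℕ) :
    ⁅C, consecSum h n (c + 1) (2 * m + 1)⁆ =
        2 * consecSum h n c (2 * m + 2) - 2 * consecSum h n (c + 1) (2 * m + 2) ∧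
      ⁅C, consecSum h n (c + 1) (2 * m + 2)⁆ =
        2 * consecSum h n c (2 * m + 3) - 2 * consecSum h n (c + 1) (2 * m + 1) ∧
      ⁅C, consecSum h n c (2 * m + 1)⁆ =
        2 * consecSum h n (c + 1) (2 * m) - 2 * consecSum h n c (2 * m) ∧
      ⁅C, consecSum h n c (2 * m + 2)⁆ =
        2 * consecSum h n (c + 1) (2 * m + 1) - 2 * consecSum h n c (2 * m + 3) := by
  have g0 : ∀ p q, ⁅C, h (c + 2 * p + 2 * q)⁆ = 0 := fun p q => by
    rw [show c + 2 * p + 2 * q = c + 2 * (p + q) by ring]; exact h0 _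
  have g1 : ∀ p q, ⁅C, h (c + 2 * p + 2 * q + 1)⁆ =
      2 * (h (c + 2 * p + 2 * q) * h (c + 2 * p + 2 * q + 1)) -
        2 * (h (c + 2 * p + 2 * q + 1) * h (c + 2 * p + 2 * q + 2)) := fun p q => by
    rw [show c + 2 * p + 2 * q = c + 2 * (p + q) by ring]; exact h1 _
  have hodd := fun p => lie_consecProd_odd hsq (g0 p) (g1 p) m
  have heven := fun p => lie_consecProd_even hsq (g0 p) (g1 p) m
  simp only [consecSum, lie_sum, Finset.mul_sum, ← Finset.sum_sub_distrib,
    fun p => show c + 1 + 2 * p = c + 2 * p + 1 by ring, (hodd _).1, (hodd _).2,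
    (heven _).1, (heven _).2, and_self]

end

end Bond

/-! ### The ideal deduced from the commutation relations -/

section AbstractLie

variable {L : Type*} [LieRing L] [LieAlgebra ℝ L] {n : ℕ} {X : L} {Y Z T : ℕ → L}

/-- Summation by parts with the three-term recurrence. The boundary terms carry `f 0`, `f (n + 2)`
and `a (n + 1)` at `l`, all zero. -/
lemma sum_a_mul_shift {l : ℝ} (hl : (a (n + 1)).IsRoot l) {f : ℕ → L} (h0 : f 0 = 0)
    (hn : f (n + 2) = 0) :
    ∑ k ∈ Finset.range (n + 1), (a k).eval l • (f (k + 2) + f k) =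
      l • ∑ k ∈ Finset.range (n + 1), (a k).eval l • f (k + 1) := by
  have key : ∀ m, ∑ k ∈ Finset.range (m + 1), (a k).eval l • (f (k + 2) + f k) =
      l • ∑ k ∈ Finset.range (m + 1), (a k).eval l • f (k + 1) +
        (a m).eval l • f (m + 2) - (a (m + 1)).eval l • f (m + 1) := by
    intro m
    induction m with
    | zero => simp [a, h0]
    | succ m ih =>
      rw [Finset.sum_range_succ, ih, Finset.sum_range_succ _ (m + 1)]
      simp only [a, Polynomial.eval_sub, Polynomial.eval_mul, Polynomial.eval_X]
      module
  rw [key, hn, hl.eq_zero]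
  simp

/-- The commutation relations satisfied by the translation-invariant string operators. -/
structure IsingRelations (n : ℕ) (X : L) (Y Z T : ℕ → L) : Prop where
  Y_zero : Y 0 = -X
  T_zero : T 0 = 0
  T_last : T (n + 2) = 0
  lie_X_Y : ∀ m, ⁅X, Y m⁆ = (2 : ℝ) • T m
  lie_X_Z : ∀ m, ⁅X, Z m⁆ = (-2 : ℝ) • T (m + 1)
  lie_X_T : ∀ m, ⁅X, T (m + 1)⁆ = (4 : ℝ) • (Z m - Y (m + 1))
  lie_Z_Y : ∀ m, ⁅Z 0, Y m⁆ = (-2 : ℝ) • T (m + 1)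
  lie_Z_Z : ∀ m, ⁅Z 0, Z m⁆ = (2 : ℝ) • T m
  lie_Z_T : ∀ m, ⁅Z 0, T (m + 1)⁆ = (4 : ℝ) • (Y m - Z (m + 1))

namespace IsingRelations

variable (h : IsingRelations n X Y Z T)
include h

/-- Each level comes from the previous one: `⁅X, Z m⁆` gives `T (m + 1)`, whose brackets with `X`
and `Z 0` give `Y (m + 1)` and `Z (m + 1)` modulo level `m`. -/
lemma mem_lieSpan (m : ℕ) :
    Y m ∈ LieSubalgebra.lieSpan ℝ L {Z 0, X} ∧ Z m ∈ LieSubalgebra.lieSpan ℝ L {Z 0, X} ∧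
      T m ∈ LieSubalgebra.lieSpan ℝ L {Z 0, X} := by
  set S := LieSubalgebra.lieSpan ℝ L {Z 0, X}
  have hX : X ∈ S := LieSubalgebra.subset_lieSpan (by simp)
  have hZ : Z 0 ∈ S := LieSubalgebra.subset_lieSpan (by simp)
  have cancel : ∀ {c : ℝ} {x : L}, c ≠ 0 → c • x ∈ S → x ∈ S := fun hc hx =>
    (S.toSubmodule.smul_mem_iff hc).1 hx
  induction m with
  | zero =>
    refine ⟨?_, hZ, ?_⟩
    · rw [h.Y_zero]; exact neg_mem hX
    · rw [h.T_zero]; exact zero_mem S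
  | succ m ih =>
    obtain ⟨hY, hZm, -⟩ := ih
    have hT : T (m + 1) ∈ S :=
      cancel (c := -2) (by norm_num) (h.lie_X_Z m ▸ S.lie_mem hX hZm)
    have h1 : Z m - Y (m + 1) ∈ S :=
      cancel (c := 4) (by norm_num) (h.lie_X_T m ▸ S.lie_mem hX hT)
    have h2 : Y m - Z (m + 1) ∈ S :=
      cancel (c := 4) (by norm_num) (h.lie_Z_T m ▸ S.lie_mem hZ hT)
    exact ⟨by simpa using sub_mem hZm h1, by simpa using sub_mem hY h2, hT⟩

/-- The three elements attached to a root `l` of `a (n + 1)` span an ideal of the Lie algebra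
generated by `Z 0` and `X`. -/
theorem exists_lieIdeal {l : ℝ} (hl : (a (n + 1)).IsRoot l) :
    ∃ I : LieIdeal ℝ (LieSubalgebra.lieSpan ℝ L {Z 0, X}),
      I.toSubmodule.map (LieSubalgebra.lieSpan ℝ L {Z 0, X}).toSubmodule.subtype =
        Submodule.span ℝ
          {∑ k ∈ Finset.range (n + 1), (a k).eval l • (Z (k + 1) - Y k),
            ∑ k ∈ Finset.range (n + 1), (a k).eval l • (Y (k + 1) - Z k),
            ∑ k ∈ Finset.range (n + 1), (a k).eval l • T (k + 1)} := by
  set S := LieSubalgebra.lieSpan ℝ L {Z 0, X} with hS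
  set x := ∑ k ∈ Finset.range (n + 1), (a k).eval l • (Z (k + 1) - Y k) with hx
  set y := ∑ k ∈ Finset.range (n + 1), (a k).eval l • (Y (k + 1) - Z k) with hy
  set z := ∑ k ∈ Finset.range (n + 1), (a k).eval l • T (k + 1) with hz
  set N := Submodule.span ℝ {x, y, z} with hN
  have hshift := sum_a_mul_shift hl h.T_zero h.T_last
  have xx : ⁅X, x⁆ = (-2 * l) • z := by
    -- The bracket of the `k`-th summand is `-2 a_k (T (k + 2) + T k)`, and the shift identity turns
    -- the sum into a multiple of `z`.
    rw [mul_smul, hz, ← hshift, hx, lie_sum, Finset.smul_sum]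
    refine Finset.sum_congr rfl fun k _ => ?_
    rw [lie_smul, lie_sub, h.lie_X_Z, h.lie_X_Y]
    module
  have xy : ⁅X, y⁆ = (4 : ℝ) • z := by
    rw [hz, hy, lie_sum, Finset.smul_sum]
    refine Finset.sum_congr rfl fun k _ => ?_
    rw [lie_smul, lie_sub, h.lie_X_Z, h.lie_X_Y]
    module
  have xz : ⁅X, z⁆ = (-4 : ℝ) • y := by
    rw [hz, hy, lie_sum, Finset.smul_sum]
    refine Finset.sum_congr rfl fun k _ => ?_
    rw [lie_smul, h.lie_X_T]
    module
  have zx : ⁅Z 0, x⁆ = (4 : ℝ) • z := by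
    rw [hz, hx, lie_sum, Finset.smul_sum]
    refine Finset.sum_congr rfl fun k _ => ?_
    rw [lie_smul, lie_sub, h.lie_Z_Z, h.lie_Z_Y]
    module
  have zy : ⁅Z 0, y⁆ = (-2 * l) • z := by
    rw [mul_smul, hz, ← hshift, hy, lie_sum, Finset.smul_sum]
    refine Finset.sum_congr rfl fun k _ => ?_
    rw [lie_smul, lie_sub, h.lie_Z_Z, h.lie_Z_Y]
    module
  have zz : ⁅Z 0, z⁆ = (-4 : ℝ) • x := by
    rw [hz, hx, lie_sum, Finset.smul_sum]
    refine Finset.sum_congr rfl fun k _ => ?_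
    rw [lie_smul, h.lie_Z_T]
    module
  have hxN : x ∈ N := Submodule.subset_span (by simp)
  have hyN : y ∈ N := Submodule.subset_span (by simp)
  have hzN : z ∈ N := Submodule.subset_span (by simp)
  have gen : ∀ u : L, ⁅u, x⁆ ∈ N → ⁅u, y⁆ ∈ N → ⁅u, z⁆ ∈ N → ∀ v ∈ N, ⁅u, v⁆ ∈ N := by
    intro u h1 h2 h3 v hv
    induction hv using Submodule.span_induction with
    | mem v hv =>
      rcases hv with rfl | rfl | rfl
      exacts [h1, h2, h3]
    | zero => simp
    | add v w _ _ hv hw => rw [lie_add]; exact add_mem hv hw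
    | smul c v _ hv => rw [lie_smul]; exact N.smul_mem c hv
  -- By the Jacobi identity the elements that preserve `N` are closed under brackets, so the two
  -- generators suffice.
  have inv : ∀ u ∈ S, ∀ v ∈ N, ⁅u, v⁆ ∈ N := by
    intro u hu
    induction hu using LieSubalgebra.lieSpan_induction with
    | mem u hu =>
      rcases hu with rfl | rfl
      · exact gen _ (zx ▸ N.smul_mem _ hzN) (zy ▸ N.smul_mem _ hzN) (zz ▸ N.smul_mem _ hxN)
      · exact gen _ (xx ▸ N.smul_mem _ hzN) (xy ▸ N.smul_mem _ hzN) (xz ▸ N.smul_mem _ hyN)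
    | zero => intro v _; simp
    | add u w _ _ hu hw => intro v hv; rw [add_lie]; exact add_mem (hu v hv) (hw v hv)
    | smul c u _ hu => intro v hv; rw [smul_lie]; exact N.smul_mem c (hu v hv)
    | lie u w _ _ hu hw =>
      intro v hv
      rw [lie_lie]
      exact sub_mem (hu _ (hw v hv)) (hw _ (hu v hv))
  have hNS : N ≤ S.toSubmodule := by
    refine Submodule.span_le.2 ?_
    rintro v (rfl | rfl | rfl)
    · exact sum_mem fun k _ => S.toSubmodule.smul_mem _
        (sub_mem (h.mem_lieSpan (k + 1)).2.1 (h.mem_lieSpan k).1)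
    · exact sum_mem fun k _ => S.toSubmodule.smul_mem _
        (sub_mem (h.mem_lieSpan (k + 1)).1 (h.mem_lieSpan k).2.1)
    · exact sum_mem fun k _ => S.toSubmodule.smul_mem _ (h.mem_lieSpan (k + 1)).2.2
  refine ⟨{ N.comap S.toSubmodule.subtype with
    lie_mem := fun {u v} hv => inv u u.2 v hv }, ?_⟩
  exact (Submodule.map_comap_subtype S.toSubmodule N).trans (inf_eq_right.2 hNS)

end IsingRelations

end AbstractLie

/-! ### Tensor products and Pauli matrices -/

section Tensor

variable {n : ℕ}

lemma tensor_mul (M N : Fin n → Matrix (Fin 2) (Fin 2) ℂ) :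
    tensor M * tensor N = tensor fun p => M p * N p := by
  ext s t
  simp only [tensor, Matrix.mul_apply, Matrix.of_apply, ← Finset.prod_mul_distrib]
  rw [Finset.prod_univ_sum, Fintype.piFinset_univ]

lemma tensor_one : tensor (fun _ : Fin n => 1) = 1 := by
  ext s t
  simp only [tensor, Matrix.of_apply, Matrix.one_apply]
  by_cases h : s = t
  · simp [h]
  · obtain ⟨p, hp⟩ := Function.ne_iff.1 h
    rw [if_neg h]
    exact Finset.prod_eq_zero (Finset.mem_univ p) (if_neg hp)

lemma tensor_smul (c : Fin n → ℂ) (M : Fin n → Matrix (Fin 2) (Fin 2) ℂ) :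
    tensor (fun p => c p • M p) = (∏ p, c p) • tensor M := by
  ext s t
  simp [tensor, Finset.prod_mul_distrib]

lemma tensor_update_smul (c : ℂ) (M : Fin n → Matrix (Fin 2) (Fin 2) ℂ) (j : Fin n)
    (N : Matrix (Fin 2) (Fin 2) ℂ) :
    tensor (Function.update M j (c • N)) = c • tensor (Function.update M j N) := by
  have h := tensor_smul (Function.update (fun _ => 1) j c) (Function.update M j N)
  rw [Finset.prod_update_of_mem (Finset.mem_univ j)] at h
  simp only [Finset.prod_const_one, mul_one] at h
  rw [← h]
  congr 1
  funext p
  by_cases hp : p = j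
  · subst hp; simp
  · simp [hp]

lemma site_smul (c : ℂ) (M : Matrix (Fin 2) (Fin 2) ℂ) (j : Fin n) :
    site (c • M) j = c • site M j :=
  tensor_update_smul c _ j M

lemma site_one (j : Fin n) : site 1 j = 1 := by
  rw [site, ← tensor_one]
  congr 1
  exact Function.update_eq_self j _

lemma tensor_mul_site (M : Fin n → Matrix (Fin 2) (Fin 2) ℂ) (N : Matrix (Fin 2) (Fin 2) ℂ)
    (j : Fin n) : tensor M * site N j = tensor (Function.update M j (M j * N)) := by
  rw [site, tensor_mul]
  congr 1
  funext p
  by_cases hp : p = j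
  · subst hp; simp
  · simp [hp]

lemma site_mul_tensor (M : Fin n → Matrix (Fin 2) (Fin 2) ℂ) (N : Matrix (Fin 2) (Fin 2) ℂ)
    (j : Fin n) : site N j * tensor M = tensor (Function.update M j (N * M j)) := by
  rw [site, tensor_mul]
  congr 1
  funext p
  by_cases hp : p = j
  · subst hp; simp
  · simp [hp]

lemma site_mul (M N : Matrix (Fin 2) (Fin 2) ℂ) (j : Fin n) :
    site M j * site N j = site (M * N) j := by
  rw [site, tensor_mul_site, site]
  simp

lemma site_commute (M N : Matrix (Fin 2) (Fin 2) ℂ) {j k : Fin n} (h : j ≠ k) :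
    Commute (site M j) (site N k) := by
  rw [Commute, SemiconjBy, site, site, tensor_mul, tensor_mul]
  congr 1
  funext p
  by_cases hj : p = j
  · subst hj; simp [h]
  · simp [hj]

lemma pauliX_sq : pauliX * pauliX = 1 := by
  simp [pauliX, Matrix.one_fin_two]

lemma pauliZ_sq : pauliZ * pauliZ = 1 := by
  simp [pauliZ, Matrix.one_fin_two]

lemma pauliX_mul_pauliZ : pauliX * pauliZ = Complex.I • pauliY := by
  simp [pauliX, pauliY, pauliZ]

lemma pauliZ_mul_pauliX : pauliZ * pauliX = -Complex.I • pauliY := by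
  simp [pauliX, pauliY, pauliZ]

lemma siteX_sq (j : Fin n) : site pauliX j * site pauliX j = 1 := by
  rw [site_mul, pauliX_sq, site_one]

lemma siteZ_sq (j : Fin n) : site pauliZ j * site pauliZ j = 1 := by
  rw [site_mul, pauliZ_sq, site_one]

lemma siteX_mul_siteZ (j : Fin n) :
    site pauliX j * site pauliZ j = Complex.I • site pauliY j := by
  rw [site_mul, pauliX_mul_pauliZ, site_smul]

lemma siteZ_mul_siteX (j : Fin n) :
    site pauliZ j * site pauliX j = -Complex.I • site pauliY j := by
  rw [site_mul, pauliZ_mul_pauliX, site_smul]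

lemma site_anticomm (j : Fin n) :
    site pauliX j * site pauliZ j = -(site pauliZ j * site pauliX j) := by
  rw [siteX_mul_siteZ, siteZ_mul_siteX, neg_smul, neg_neg]

end Tensor

/-! ### Cyclic translation and symmetrization -/

section Translate

variable {n : ℕ}

/-- Conjugation by the one-step translation. -/
def translate (A : Op n) : Op n := shift n * A * (shift n).transpose

lemma translate_eq_submatrix (A : Op n) :
    translate A = A.submatrix ((finRotate n).arrowCongr (Equiv.refl (Fin 2)))
      ((finRotate n).arrowCongr (Equiv.refl (Fin 2))) := by
  rw [translate, shift, Matrix.transpose_permMatrix, Equiv.Perm.permMatrix, Equiv.Perm.permMatrix,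
    PEquiv.toMatrix_toPEquiv_mul, PEquiv.mul_toMatrix_toPEquiv]
  rfl

lemma translate_apply (A : Op n) (s t : Fin n → Fin 2) :
    translate A s t = A (s ∘ (finRotate n).symm) (t ∘ (finRotate n).symm) := by
  rw [translate_eq_submatrix]
  rfl

lemma translate_tensor (M : Fin n → Matrix (Fin 2) (Fin 2) ℂ) :
    translate (tensor M) = tensor fun p => M (finRotate n p) := by
  ext s t
  rw [translate_apply]
  simp only [tensor, Matrix.of_apply, Function.comp_apply]
  rw [← Equiv.prod_comp (finRotate n)]
  simp only [Equiv.symm_apply_apply]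

lemma translate_mul (A B : Op n) : translate (A * B) = translate A * translate B := by
  simp only [translate_eq_submatrix, Matrix.submatrix_mul_equiv]

lemma translate_one : translate (1 : Op n) = 1 := by
  rw [← tensor_one, translate_tensor]

lemma translate_smul (c : ℂ) (A : Op n) : translate (c • A) = c • translate A := by
  simp [translate]

lemma translate_site (M : Matrix (Fin 2) (Fin 2) ℂ) (j : Fin n) :
    translate (site M (finRotate n j)) = site M j := by
  rw [site, translate_tensor, site]
  congr 1
  funext p
  by_cases hp : p = j
  · subst hp; simp
  · simp [hp]

lemma symmetrize_eq (A : Op n) :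
    symmetrize A = ∑ k ∈ Finset.range n, translate^[k] A := by
  refine Finset.sum_congr rfl fun k hk => ?_
  clear hk
  induction k with
  | zero => simp
  | succ k ih =>
    rw [Function.iterate_succ_apply', ← ih, translate, pow_succ']
    simp only [Matrix.transpose_mul, mul_assoc]

lemma symmetrize_smul (c : ℂ) (A : Op n) : symmetrize (c • A) = c • symmetrize A := by
  simp [symmetrize, Finset.smul_sum]

/-- The symmetrization of a member of a translation-covariant periodic family is the sum over a
period. -/
lemma symmetrize_eq_sum {f : ℕ → Op n} (hf : ∀ p, translate (f (p + 1)) = f p)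
    (hper : f n = f 0) : symmetrize (f 0) = ∑ p ∈ Finset.range n, f p := by
  have key : ∀ k p, translate^[k] (f (p + k)) = f p := by
    intro k
    induction k with
    | zero => intro p; rfl
    | succ k ih =>
      intro p
      rw [Function.iterate_succ_apply, ← add_assoc, hf, ih]
  rw [symmetrize_eq, ← sum_range_succ_of_periodic hper, ← Finset.sum_range_reflect]
  refine Finset.sum_congr rfl fun k hk => ?_
  have hk := Finset.mem_range.1 hk
  -- Translation lowers the index, so `f 0` is first replaced by `f n`.
  rw [← hper, show f n = f (k + 1 + (n - 1 - k)) by congr 1; omega, key]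

end Translate

/-! ### The bonds of the Ising chain -/

section BondOperators

variable {n : ℕ}

lemma finRotate_ne (hn : 2 ≤ n) (j : Fin n) : finRotate n j ≠ j := by
  have := support_finRotate_of_le hn
  exact Equiv.Perm.mem_support.1 (this ▸ Finset.mem_univ j)

/-- The coupling `σ_z^j σ_z^{j+1}`. -/
def coupling (j : Fin n) : Op n := site pauliZ j * site pauliZ (finRotate n j)

lemma coupling_sq (hn : 2 ≤ n) (j : Fin n) : coupling j * coupling j = 1 := by
  have h := site_commute pauliZ pauliZ (finRotate_ne hn j)
  rw [coupling, mul_assoc, ← mul_assoc (site pauliZ (finRotate n j)), h.eq, mul_assoc, siteZ_sq,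
    mul_one, siteZ_sq]

lemma siteX_commute_coupling {j k : Fin n} (h : k ≠ j) (h' : k ≠ finRotate n j) :
    Commute (site pauliX k) (coupling j) :=
  (site_commute _ _ h).mul_right (site_commute _ _ h')

lemma siteX_mul_coupling (hn : 2 ≤ n) (j : Fin n) :
    site pauliX j * coupling j = -(coupling j * site pauliX j) := by
  have h := site_commute pauliX pauliZ (finRotate_ne hn j).symm
  rw [coupling, ← mul_assoc, site_anticomm, neg_mul, mul_assoc, h.eq, mul_assoc]

lemma siteX_finRotate_mul_coupling (hn : 2 ≤ n) (j : Fin n) :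
    site pauliX (finRotate n j) * coupling j =
      -(coupling j * site pauliX (finRotate n j)) := by
  have h := site_commute pauliX pauliZ (finRotate_ne hn j)
  rw [coupling, ← mul_assoc, h.eq, mul_assoc, site_anticomm, mul_neg, mul_assoc]

lemma coupling_commute (j k : Fin n) : Commute (coupling j) (coupling k) := by
  have h : ∀ j k : Fin n, Commute (site pauliZ j) (site pauliZ k) := fun j k => by
    by_cases e : j = k
    · rw [e]
    · exact site_commute _ _ e
  exact ((h _ _).mul_right (h _ _)).mul_left ((h _ _).mul_right (h _ _))

lemma siteX_commute (j k : Fin n) : Commute (site pauliX j) (site pauliX k) := by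
  by_cases e : j = k
  · rw [e]
  · exact site_commute _ _ e

lemma lie_H1_siteX (j : Fin n) : ⁅H1 n, site pauliX j⁆ = 0 :=
  (Commute.sum_left _ _ _ fun k _ => siteX_commute k j).lie_eq

lemma lie_H0_coupling (j : Fin n) : ⁅H0 n, coupling j⁆ = 0 :=
  (Commute.sum_left _ _ _ fun k _ => coupling_commute k j).lie_eq

lemma lie_H1_coupling (hn : 2 ≤ n) (j : Fin n) :
    ⁅H1 n, coupling j⁆ =
      2 * (site pauliX j * coupling j) - 2 * (coupling j * site pauliX (finRotate n j)) := by
  rw [H1, sum_lie, Fintype.sum_eq_add j (finRotate n j) (finRotate_ne hn j).symm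
    fun k hk => (siteX_commute_coupling hk.1 hk.2).lie_eq]
  have h1 := siteX_mul_coupling hn j
  have h2 := siteX_finRotate_mul_coupling hn j
  rw [Ring.lie_def, Ring.lie_def]
  linear_combination (norm := noncomm_ring) -h1 + h2

lemma lie_H0_siteX (hn : 2 ≤ n) (j : Fin n) :
    ⁅H0 n, site pauliX (finRotate n j)⁆ =
      2 * (coupling j * site pauliX (finRotate n j)) -
        2 * (site pauliX (finRotate n j) * coupling (finRotate n j)) := by
  change ⁅∑ k, coupling k, _⁆ = _
  rw [sum_lie, Fintype.sum_eq_add j (finRotate n j) (finRotate_ne hn j).symm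
    fun k hk => (siteX_commute_coupling hk.2.symm
      fun e => hk.1 ((finRotate n).injective e).symm).symm.lie_eq]
  have h1 := siteX_mul_coupling hn (finRotate n j)
  have h2 := siteX_finRotate_mul_coupling hn j
  rw [Ring.lie_def, Ring.lie_def]
  linear_combination (norm := noncomm_ring) h1 - h2

section NeZero

variable [NeZero n]

lemma ofNat_succ (p : ℕ) : Fin.ofNat n (p + 1) = finRotate n (Fin.ofNat n p) := by
  rw [finRotate_apply]
  ext
  simp [Fin.val_add]

lemma ofNat_add_period (p : ℕ) : Fin.ofNat n (p + n) = Fin.ofNat n p := by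
  ext
  simp

lemma ofNat_ne {p q : ℕ} (h : p < q) (h' : q < p + n) : Fin.ofNat n p ≠ Fin.ofNat n q := by
  intro e
  have e' : p ≡ q [MOD n] := congrArg Fin.val e
  have := Nat.le_of_dvd (by omega) ((Nat.modEq_iff_dvd' h.le).1 e')
  omega

lemma sum_range_ofNat {M : Type*} [AddCommMonoid M] (f : Fin n → M) :
    ∑ p ∈ Finset.range n, f (Fin.ofNat n p) = ∑ j, f j := by
  rw [Finset.sum_range]
  refine Finset.sum_congr rfl fun j _ => ?_
  congr 1
  ext
  simp

variable (n) in
/-- The generators of the bond algebra: `σ_x^p` in position `2 p`, and `σ_z^p σ_z^{p+1}` in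
position `2 p + 1`. -/
def bond (i : ℕ) : Op n :=
  if i % 2 = 0 then site pauliX (Fin.ofNat n (i / 2)) else coupling (Fin.ofNat n (i / 2))

lemma bond_even (p : ℕ) : bond n (2 * p) = site pauliX (Fin.ofNat n p) := by
  simp [bond]

lemma bond_odd (p : ℕ) : bond n (2 * p + 1) = coupling (Fin.ofNat n p) := by
  rw [bond, if_neg (by omega)]
  congr 2
  omega

lemma bond_add_period (i : ℕ) : bond n (i + 2 * n) = bond n i := by
  rcases Nat.even_or_odd' i with ⟨p, rfl | rfl⟩
  · rw [← mul_add, bond_even, bond_even, ofNat_add_period]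
  · rw [show 2 * p + 1 + 2 * n = 2 * (p + n) + 1 by ring, bond_odd, bond_odd, ofNat_add_period]

lemma bond_sq (hn : 2 ≤ n) (i : ℕ) : bond n i * bond n i = 1 := by
  rcases Nat.even_or_odd' i with ⟨p, rfl | rfl⟩
  · rw [bond_even, siteX_sq]
  · rw [bond_odd, coupling_sq hn]

lemma consecSum_bond_zero_one : consecSum (bond n) n 0 1 = H1 n := by
  rw [H1, ← sum_range_ofNat, consecSum]
  simp [bond_even]

lemma consecSum_bond_one_one : consecSum (bond n) n 1 1 = H0 n := by
  change _ = ∑ j, coupling j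
  rw [← sum_range_ofNat, consecSum]
  simp [add_comm 1, bond_odd]

lemma lie_H1_bond_even (q : ℕ) : ⁅H1 n, bond n (0 + 2 * q)⁆ = 0 := by
  rw [zero_add, bond_even, lie_H1_siteX]

lemma lie_H1_bond_odd (hn : 2 ≤ n) (q : ℕ) : ⁅H1 n, bond n (0 + 2 * q + 1)⁆ =
    2 * (bond n (0 + 2 * q) * bond n (0 + 2 * q + 1)) -
      2 * (bond n (0 + 2 * q + 1) * bond n (0 + 2 * q + 2)) := by
  rw [zero_add, show 2 * q + 2 = 2 * (q + 1) by ring, bond_even, bond_even, bond_odd,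
    lie_H1_coupling hn, ofNat_succ]

lemma lie_H0_bond_odd (q : ℕ) : ⁅H0 n, bond n (1 + 2 * q)⁆ = 0 := by
  rw [add_comm, bond_odd, lie_H0_coupling]

lemma lie_H0_bond_even (hn : 2 ≤ n) (q : ℕ) : ⁅H0 n, bond n (1 + 2 * q + 1)⁆ =
    2 * (bond n (1 + 2 * q) * bond n (1 + 2 * q + 1)) -
      2 * (bond n (1 + 2 * q + 1) * bond n (1 + 2 * q + 2)) := by
  rw [show 1 + 2 * q + 2 = 2 * (q + 1) + 1 by ring, show 1 + 2 * q + 1 = 2 * (q + 1) by ring,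
    add_comm 1, bond_even, bond_odd, bond_odd, ofNat_succ, lie_H0_siteX hn]

/-- The bond `2p` is moved from the front to the back of the full product. It anticommutes with its
neighbours `2p + 1` and `2p + 2n - 1` and commutes with the block `W` between them, so the two signs
cancel. -/
lemma consecProd_bond_full (hn : 2 ≤ n) (p : ℕ) :
    consecProd (bond n) (2 * p + 1) (2 * n) = consecProd (bond n) (2 * p) (2 * n) := by
  obtain ⟨m, rfl⟩ := Nat.exists_eq_add_of_le' hn
  set W := consecProd (bond (m + 2)) (2 * p + 2) (2 * m + 1) with hW
  have hcomm : Commute (bond (m + 2) (2 * p)) W := by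
    refine Commute.consecProd_right _ _ fun k hk => ?_
    rcases Nat.even_or_odd' k with ⟨r, rfl | rfl⟩
    · rw [show 2 * p + 2 + 2 * r = 2 * (p + 1 + r) by ring, bond_even, bond_even]
      exact siteX_commute _ _
    · rw [show 2 * p + 2 + (2 * r + 1) = 2 * (p + 1 + r) + 1 by ring, bond_even, bond_odd]
      refine siteX_commute_coupling (ofNat_ne (by omega) (by omega)) ?_
      rw [← ofNat_succ]
      exact ofNat_ne (by omega) (by omega)
  have h1 : consecProd (bond (m + 2)) (2 * p + 1) (2 * m + 3) =
      bond (m + 2) (2 * p + 1) * W * bond (m + 2) (2 * (p + (m + 1)) + 1) := by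
    rw [consecProd_succ', consecProd_succ, mul_assoc]
    congr 3
    ring
  have hl : bond (m + 2) (2 * p) * bond (m + 2) (2 * p + 1) =
      -(bond (m + 2) (2 * p + 1) * bond (m + 2) (2 * p)) := by
    rw [bond_even, bond_odd, siteX_mul_coupling hn]
  have hr : bond (m + 2) (2 * p) * bond (m + 2) (2 * (p + (m + 1)) + 1) =
      -(bond (m + 2) (2 * (p + (m + 1)) + 1) * bond (m + 2) (2 * p)) := by
    rw [← bond_add_period (2 * p), ← mul_add, bond_even, bond_odd,
      show p + (m + 2) = p + (m + 1) + 1 by ring, ofNat_succ, siteX_finRotate_mul_coupling hn]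
  rw [show 2 * (m + 2) = 2 * m + 3 + 1 by ring, consecProd_succ, consecProd_succ' (2 * p), h1,
    show 2 * p + 1 + (2 * m + 3) = 2 * p + 2 * (m + 2) by ring, bond_add_period,
    ← mul_assoc, ← mul_assoc, hl, neg_mul, neg_mul, mul_assoc _ _ W, hcomm.eq]
  simp only [mul_assoc]
  rw [hr]
  simp

lemma consecSum_bond_full (hn : 2 ≤ n) :
    consecSum (bond n) n 1 (2 * n) = consecSum (bond n) n 0 (2 * n) := by
  refine Finset.sum_congr rfl fun p _ => ?_
  rw [zero_add, add_comm, consecProd_bond_full hn]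

lemma translate_bond (i : ℕ) : translate (bond n (i + 2)) = bond n i := by
  rcases Nat.even_or_odd' i with ⟨p, rfl | rfl⟩
  · rw [show 2 * p + 2 = 2 * (p + 1) by ring, bond_even, bond_even, ofNat_succ, translate_site]
  · rw [show 2 * p + 1 + 2 = 2 * (p + 1) + 1 by ring, bond_odd, bond_odd, coupling,
      translate_mul, translate_site, ofNat_succ, translate_site, coupling]

lemma translate_consecProd_bond (i m : ℕ) :
    translate (consecProd (bond n) (i + 2) m) = consecProd (bond n) i m := by
  induction m with
  | zero => exact translate_one
  | succ m ih =>
    rw [consecProd_succ, translate_mul, ih, show i + 2 + m = i + m + 2 by ring, translate_bond,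
      consecProd_succ]

lemma symmetrize_consecProd_bond (c m : ℕ) :
    symmetrize (consecProd (bond n) c m) = consecSum (bond n) n c m :=
  symmetrize_eq_sum (f := fun p => consecProd (bond n) (c + 2 * p) m)
    (fun p => translate_consecProd_bond (c + 2 * p) m)
    (consecProd_add_period bond_add_period c m)

/-- Serves `𝐗𝐗`, whose string is a bond product only after one translation. -/
lemma symmetrize_translate_consecProd_bond (c m : ℕ) :
    symmetrize (translate (consecProd (bond n) c m)) = consecSum (bond n) n c m := by
  have hf : ∀ p, translate (consecProd (bond n) (c + 2 * (p + 1)) m) =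
      consecProd (bond n) (c + 2 * p) m := fun p => translate_consecProd_bond (c + 2 * p) m
  have hper : translate (consecProd (bond n) (c + 2 * n) m) =
      translate (consecProd (bond n) (c + 2 * 0) m) := by
    rw [consecProd_add_period bond_add_period, mul_zero, add_zero]
  rw [← add_zero c, ← mul_zero 2,
    symmetrize_eq_sum (f := fun p => translate (consecProd (bond n) (c + 2 * p) m))
      (fun p => by simp only [hf]) hper,
    ← sum_range_succ_of_periodic hper]
  simp only [hf]
  rfl

end NeZero

end BondOperators

/-! ### Pauli strings as products of bonds -/

section Strings

variable {n : ℕ}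

lemma ofNat_val_of_lt [NeZero n] {p : ℕ} (hp : p < n) : (Fin.ofNat n p : ℕ) = p := by
  simp [Nat.mod_eq_of_lt hp]

/-- The operator `M ⊗ σ_x^{⊗ k} ⊗ 1^{⊗ (n-k-1)}`. -/
def halfString (n k : ℕ) (M : Matrix (Fin 2) (Fin 2) ℂ) : Op n :=
  tensor fun p => if (p : ℕ) = 0 then M else if (p : ℕ) ≤ k then pauliX else 1

variable [NeZero n]

lemma halfString_zero (M : Matrix (Fin 2) (Fin 2) ℂ) :
    halfString n 0 M = site M (Fin.ofNat n 0) := by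
  rw [halfString, site]
  congr 1
  funext p
  by_cases hp : p = Fin.ofNat n 0
  · subst hp; simp
  · have : (p : ℕ) ≠ 0 := fun e => hp (Fin.ext (by simpa using e))
    rw [if_neg this, if_neg (by omega), Function.update_of_ne hp]

lemma halfString_mul_siteX {k : ℕ} (hk : k + 1 < n) (M : Matrix (Fin 2) (Fin 2) ℂ) :
    halfString n k M * site pauliX (Fin.ofNat n (k + 1)) = halfString n (k + 1) M := by
  rw [halfString, tensor_mul_site, halfString]
  congr 1
  funext p
  have hv := ofNat_val_of_lt hk
  by_cases hp : p = Fin.ofNat n (k + 1)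
  · subst hp; simp only [Function.update_self, hv]; simp
  · have : (p : ℕ) ≠ k + 1 := fun e => hp (Fin.ext (by rw [hv, e]))
    rw [Function.update_of_ne hp]
    simp only [show (p : ℕ) ≤ k + 1 ↔ (p : ℕ) ≤ k by omega]

lemma halfString_mul_site {k : ℕ} (hk : k + 1 < n) (M N : Matrix (Fin 2) (Fin 2) ℂ) :
    halfString n k M * site N (Fin.ofNat n (k + 1)) = stringOp n k M N := by
  rw [halfString, tensor_mul_site, stringOp]
  congr 1
  funext p
  have hv := ofNat_val_of_lt hk
  by_cases hp : p = Fin.ofNat n (k + 1)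
  · subst hp; simp only [Function.update_self, hv]; simp
  · have : (p : ℕ) ≠ k + 1 := fun e => hp (Fin.ext (by rw [hv, e]))
    rw [Function.update_of_ne hp, if_neg this]

lemma site_mul_halfString (k : ℕ) (M N : Matrix (Fin 2) (Fin 2) ℂ) :
    site N (Fin.ofNat n 0) * halfString n k M = halfString n k (N * M) := by
  rw [halfString, site_mul_tensor, halfString]
  congr 1
  funext p
  by_cases hp : p = Fin.ofNat n 0
  · subst hp; simp
  · have : (p : ℕ) ≠ 0 := fun e => hp (Fin.ext (by simpa using e))
    rw [Function.update_of_ne hp, if_neg this, if_neg this]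

lemma halfString_smul (k : ℕ) (c : ℂ) (M : Matrix (Fin 2) (Fin 2) ℂ) :
    halfString n k (c • M) = c • halfString n k M := by
  have h := site_mul_halfString (n := n) k M (c • 1)
  rw [site_smul, site_one, smul_mul_assoc, smul_mul_assoc, one_mul, one_mul] at h
  exact h.symm

/-- At each interior site two couplings enclose a `σ_x`, and `σ_z σ_x σ_z = -σ_x`, whence the sign.
The case `k = n - 1` is allowed: the last `σ_z` then wraps around to site `0`, as `𝐗𝐗` requires. -/
lemma consecProd_bond_one_odd (k : ℕ) (hk : k < n) :
    consecProd (bond n) 1 (2 * k + 1) =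
      (-1 : ℂ) ^ k • (halfString n k pauliZ * site pauliZ (Fin.ofNat n (k + 1))) := by
  induction k with
  | zero =>
    rw [mul_zero, zero_add, consecProd_one, halfString_zero, pow_zero, one_smul,
      show (1 : ℕ) = 2 * 0 + 1 by rfl, bond_odd, coupling, ofNat_succ]
  | succ k ih =>
    rw [show 2 * (k + 1) + 1 = 2 * k + 1 + 1 + 1 by ring, consecProd_succ, consecProd_succ,
      ih (by omega), show 1 + (2 * k + 1) = 2 * (k + 1) by ring,
      show 1 + (2 * k + 1 + 1) = 2 * (k + 1) + 1 by ring, bond_even, bond_odd, coupling,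
      ← ofNat_succ, ← halfString_mul_siteX hk]
    set x := site pauliX (Fin.ofNat n (k + 1))
    set z := site pauliZ (Fin.ofNat n (k + 1))
    have h1 : z * x * z = -x := by
      have h := site_anticomm (Fin.ofNat n (k + 1))
      rw [mul_assoc, h, mul_neg, ← mul_assoc, siteZ_sq, one_mul]
    set w := site pauliZ (Fin.ofNat n (k + 1 + 1))
    calc _ = (-1 : ℂ) ^ k • (halfString n k pauliZ * (z * x * z) * w) := by
            simp only [smul_mul_assoc, mul_assoc]
      _ = _ := by rw [h1, pow_succ]; simp

lemma consecProd_bond_one_even (k : ℕ) (hk : k < n) :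
    consecProd (bond n) 1 (2 * k + 2) =
      (-(-1 : ℂ) ^ k * Complex.I) • (halfString n k pauliZ * site pauliY (Fin.ofNat n (k + 1))) := by
  rw [consecProd_succ, consecProd_bond_one_odd k hk, show 1 + (2 * k + 1) = 2 * (k + 1) by ring,
    bond_even, smul_mul_assoc, mul_assoc, siteZ_mul_siteX, mul_smul_comm, smul_smul]
  congr 1
  ring

lemma siteX_mul_halfString_pauliZ (k : ℕ) :
    site pauliX (Fin.ofNat n 0) * halfString n k pauliZ = Complex.I • halfString n k pauliY := by
  rw [site_mul_halfString, pauliX_mul_pauliZ, halfString_smul]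

lemma consecProd_bond_zero_even (k : ℕ) (hk : k < n) :
    consecProd (bond n) 0 (2 * k + 2) =
      ((-1 : ℂ) ^ k * Complex.I) • (halfString n k pauliY * site pauliZ (Fin.ofNat n (k + 1))) := by
  rw [consecProd_succ', zero_add, consecProd_bond_one_odd k hk, show (0 : ℕ) = 2 * 0 by rfl,
    bond_even, mul_smul_comm, ← mul_assoc, siteX_mul_halfString_pauliZ, smul_mul_assoc, smul_smul]

lemma consecProd_bond_zero_odd (k : ℕ) (hk : k < n) :
    consecProd (bond n) 0 (2 * k + 3) =
      (-1 : ℂ) ^ k • (halfString n k pauliY * site pauliY (Fin.ofNat n (k + 1))) := by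
  rw [consecProd_succ', zero_add, consecProd_bond_one_even k hk, show (0 : ℕ) = 2 * 0 by rfl,
    bond_even, mul_smul_comm, ← mul_assoc, siteX_mul_halfString_pauliZ, smul_mul_assoc, smul_smul,
    mul_assoc, Complex.I_mul_I]
  congr 1
  ring

lemma neg_one_pow_mul_self (k : ℕ) : (-1 : ℂ) ^ k * (-1) ^ k = 1 := by
  rw [← mul_pow]; simp

lemma opX_eq : opX n = Complex.I • consecSum (bond n) n 0 1 := by
  rw [← symmetrize_consecProd_bond, consecProd_one, show (0 : ℕ) = 2 * 0 by rfl, bond_even,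
    ← halfString_zero, opX, halfString]
  congr 3
  funext p
  by_cases hp : (p : ℕ) = 0 <;> simp [hp]

lemma opZ_eq {k : ℕ} (hk : k + 1 < n) :
    opZ n k = ((-1) ^ k * Complex.I) • consecSum (bond n) n 1 (2 * k + 1) := by
  rw [← symmetrize_consecProd_bond, consecProd_bond_one_odd k (by omega), halfString_mul_site hk,
    symmetrize_smul, smul_smul, opZ]
  congr 1
  linear_combination -Complex.I * neg_one_pow_mul_self k

lemma opY_eq {k : ℕ} (hk : k + 1 < n) :
    opY n k = ((-1) ^ k * Complex.I) • consecSum (bond n) n 0 (2 * k + 3) := by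
  rw [← symmetrize_consecProd_bond, consecProd_bond_zero_odd k (by omega), halfString_mul_site hk,
    symmetrize_smul, smul_smul, opY]
  congr 1
  linear_combination -Complex.I * neg_one_pow_mul_self k

lemma opYZ_eq {k : ℕ} (hk : k + 1 < n) :
    opYZ n k = (-1 : ℂ) ^ (k + 1) •
      (consecSum (bond n) n 1 (2 * k + 2) - consecSum (bond n) n 0 (2 * k + 2)) := by
  rw [← symmetrize_consecProd_bond, ← symmetrize_consecProd_bond,
    consecProd_bond_one_even k (by omega), consecProd_bond_zero_even k (by omega),
    halfString_mul_site hk, halfString_mul_site hk, symmetrize_smul, symmetrize_smul, smul_sub,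
    smul_smul, smul_smul, sub_eq_add_neg, ← neg_smul, opYZ]
  congr 2
  · linear_combination -Complex.I * neg_one_pow_mul_self k
  · linear_combination -Complex.I * neg_one_pow_mul_self k

lemma opXX_eq (hn : 2 ≤ n) :
    opXX n = ((-1) ^ (n - 1) * Complex.I) • consecSum (bond n) n 1 (2 * (n - 1) + 1) := by
  -- In the string that wraps around, the two end `σ_z` meet at site `0` and give the identity. The
  -- translation carries that identity to the last site.
  have e : (tensor fun p : Fin n => if (p : ℕ) < n - 1 then pauliX else 1) =
      translate (halfString n (n - 1) pauliZ * site pauliZ (Fin.ofNat n (n - 1 + 1))) := by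
    rw [show n - 1 + 1 = 0 + n by omega, ofNat_add_period, halfString, tensor_mul_site,
      translate_tensor]
    congr 1
    funext p
    have hr : finRotate n p = Fin.ofNat n (p + 1) := by
      rw [ofNat_succ]
      congr 1
      exact Fin.ext (ofNat_val_of_lt p.2).symm
    by_cases hp : (p : ℕ) < n - 1
    · have hv : ((finRotate n p : Fin n) : ℕ) = p + 1 := by
        rw [hr, ofNat_val_of_lt (by omega)]
      have hne : finRotate n p ≠ Fin.ofNat n 0 := fun h => by
        rw [h] at hv; simp at hv
      rw [Function.update_of_ne hne, if_pos hp, hv, if_neg (by omega), if_pos (by omega)]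
    · have hv : finRotate n p = Fin.ofNat n 0 := by
        rw [hr, show (p : ℕ) + 1 = 0 + n by omega, ofNat_add_period]
      rw [hv, if_neg hp]
      simp [pauliZ_sq]
  have h := consecProd_bond_one_odd (n := n) (n - 1) (by omega)
  have h' : halfString n (n - 1) pauliZ * site pauliZ (Fin.ofNat n (n - 1 + 1)) =
      (-1 : ℂ) ^ (n - 1) • consecProd (bond n) 1 (2 * (n - 1) + 1) := by
    rw [h, smul_smul, neg_one_pow_mul_self, one_smul]
  rw [opXX, e, h', translate_smul, symmetrize_smul, symmetrize_translate_consecProd_bond, smul_smul,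
    mul_comm]

end Strings

/-! ### The relations for the chain and the ideal -/

section Main

variable {n : ℕ}

lemma lie_imag_smul (s t : ℂ) (A B : Op n) :
    ⁅(s * Complex.I) • A, (t * Complex.I) • B⁆ = (-(s * t)) • ⁅A, B⁆ := by
  rw [smul_lie, lie_smul, smul_smul]
  congr 1
  linear_combination s * t * Complex.I_mul_I

/-- The ring has `N + 2` sites. The signs absorb the `(-1) ^ k` of the strings, so that `Z k`, `Y (k
+ 1)` and `T (k + 1)` are `𝐙^k`, `𝐘^k` and `𝐘𝐙^k`. -/
lemma isingRelations (N : ℕ) :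
    IsingRelations N (Complex.I • H1 (N + 2))
      (fun m => (-(-1) ^ m * Complex.I) • consecSum (bond (N + 2)) (N + 2) 0 (2 * m + 1))
      (fun m => ((-1) ^ m * Complex.I) • consecSum (bond (N + 2)) (N + 2) 1 (2 * m + 1))
      (fun m => (-1 : ℂ) ^ m • (consecSum (bond (N + 2)) (N + 2) 1 (2 * m) -
        consecSum (bond (N + 2)) (N + 2) 0 (2 * m))) := by
  have hn : 2 ≤ N + 2 := by omega
  have hA := lie_consecSum (n := N + 2) (bond_sq hn) lie_H1_bond_even (lie_H1_bond_odd hn)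
  have hB := lie_consecSum (n := N + 2) (bond_sq hn) lie_H0_bond_odd (lie_H0_bond_even hn)
  simp only [zero_add, Nat.reduceAdd, consecSum_two bond_add_period,
    two_mul (_ : Op (N + 2))] at hA hB
  have hX : Complex.I • H1 (N + 2) = (1 * Complex.I) • H1 (N + 2) := by rw [one_mul]
  have hZ : ((-1) ^ 0 * Complex.I) • consecSum (bond (N + 2)) (N + 2) 1 (2 * 0 + 1) =
      (1 * Complex.I) • H0 (N + 2) := by
    rw [mul_zero, zero_add, consecSum_bond_one_one, pow_zero]
  have h2 : ∀ A : Op (N + 2), (2 : ℝ) • A = (2 : ℂ) • A := fun A => by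
    rw [two_smul, two_smul]
  have hneg : ∀ A : Op (N + 2), (-2 : ℝ) • A = (-2 : ℂ) • A := fun A => by
    rw [neg_smul, neg_smul, h2]
  have h4 : ∀ A : Op (N + 2), (4 : ℝ) • A = (4 : ℂ) • A := fun A => by
    rw [show (4 : ℝ) = 2 * 2 by norm_num, show (4 : ℂ) = 2 * 2 by norm_num, mul_smul, mul_smul,
      h2, h2]
  constructor
  · simp [consecSum_bond_zero_one]
  -- Both sums consist of the same number of empty products.
  · simp [consecSum]
  · simp only [consecSum_bond_full hn, sub_self, smul_zero]
  · intro m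
    rw [hX, lie_imag_smul, (hA m).2.2.1, h2]
    module
  · intro m
    rw [hX, lie_imag_smul, (hA m).1, hneg, mul_add, mul_one, pow_succ]
    module
  · intro m
    rw [lie_smul, smul_lie, mul_add, mul_one, lie_sub, (hA m).2.1, (hA m).2.2.2, h4,
      show 2 * m + 2 + 1 = 2 * m + 3 by ring, pow_succ]
    module
  · intro m
    rw [hZ, lie_imag_smul, (hB m).1, hneg, mul_add, mul_one, pow_succ]
    module
  · intro m
    rw [hZ, lie_imag_smul, (hB m).2.2.1, h2]
    module
  · intro m
    rw [hZ, one_mul, lie_smul, smul_lie, mul_add, mul_one, lie_sub, (hB m).2.1, (hB m).2.2.2, h4,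
      show 2 * m + 2 + 1 = 2 * m + 3 by ring, pow_succ]
    module

/-- A root of `a (n - 1)` gives a three-element spanning set of an ideal of the dynamical Lie
algebra of the periodic Ising chain. -/
theorem exists_lieIdeal_hat (n : ℕ) (hn : 3 ≤ n) (l : ℝ) (hl : (a (n - 1)).IsRoot l) :
    ∃ I : LieIdeal ℝ (dynamicalLieAlgebra n),
      I.toSubmodule.map (dynamicalLieAlgebra n).toSubmodule.subtype =
        Submodule.span ℝ
          {hatX n l, hatY n l, hatZ n l} := by
  obtain ⟨N, rfl⟩ := Nat.exists_eq_add_of_le' hn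
  have h := isingRelations (N + 1)
  set Y : ℕ → Op (N + 3) := fun m =>
    (-(-1) ^ m * Complex.I) • consecSum (bond (N + 3)) (N + 3) 0 (2 * m + 1) with hY
  set Z : ℕ → Op (N + 3) := fun m =>
    ((-1) ^ m * Complex.I) • consecSum (bond (N + 3)) (N + 3) 1 (2 * m + 1) with hZ
  set T : ℕ → Op (N + 3) := fun m =>
    (-1 : ℂ) ^ m • (consecSum (bond (N + 3)) (N + 3) 1 (2 * m) -
      consecSum (bond (N + 3)) (N + 3) 0 (2 * m)) with hT
  have hZ0 : Z 0 = Complex.I • H0 (N + 3) := by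
    simp [hZ, consecSum_bond_one_one]
  have eZ : ∀ k, k + 1 < N + 3 → opZ (N + 3) k = Z k := fun k hk => opZ_eq hk
  have eY : ∀ k, k + 1 < N + 3 → opY (N + 3) k = Y (k + 1) := fun k hk => by
    rw [opY_eq hk, hY]
    simp only [pow_succ, mul_neg, mul_one, neg_neg]
    rfl
  have eT : ∀ k, k + 1 < N + 3 → opYZ (N + 3) k = T (k + 1) := fun k hk => opYZ_eq hk
  have eX : opX (N + 3) = -Y 0 := by
    rw [opX_eq, hY]; simp
  have eXX : opXX (N + 3) = Z (N + 2) := opXX_eq (by omega)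
  have key := h.exists_lieIdeal hl
  rw [hZ0] at key
  -- Since `Y 0 = -𝐗` and `Z (N + 2) = 𝐗𝐗`, the two exceptional terms of `X̂` are the summands `k =
  -- 0` and `k = N + 1` of one uniform sum.
  have hx : hatX (N + 3) l =
      ∑ k ∈ Finset.range (N + 1 + 1), (a k).eval l • (Z (k + 1) - Y k) := by
    rw [Finset.sum_range_succ, Finset.sum_range_succ', hatX, eX, eXX, eZ 1 (by omega),
      Nat.add_sub_cancel, show N + 3 - 2 = N + 1 by omega, eY N (by omega),
      Finset.range_eq_Ico, Finset.sum_Ico_add' (fun k => (a k).eval l • (Z (k + 1) - Y k)),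
      zero_add, ← Finset.Ico_add_one_right_eq_Icc]
    have : ∑ k ∈ Finset.Ico 1 (N + 1), (a k).eval l • (opZ (N + 3) (k + 1) - opY (N + 3) (k - 1))
        = ∑ k ∈ Finset.Ico 1 (N + 1), (a k).eval l • (Z (k + 1) - Y k) := by
      refine Finset.sum_congr rfl fun k hk => ?_
      have hk := Finset.mem_Ico.1 hk
      rw [eZ _ (by omega), eY _ (by omega), Nat.sub_add_cancel hk.1]
    rw [this]
    module
  have hrange : Finset.Icc 0 (N + 3 - 2) = Finset.range (N + 1 + 1) := by
    ext k; simp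
  have hy : hatY (N + 3) l =
      ∑ k ∈ Finset.range (N + 1 + 1), (a k).eval l • (Y (k + 1) - Z k) := by
    rw [hatY, hrange]
    refine Finset.sum_congr rfl fun k hk => ?_
    have hk := Finset.mem_range.1 hk
    rw [eZ _ (by omega), eY _ (by omega)]
  have hz : hatZ (N + 3) l = ∑ k ∈ Finset.range (N + 1 + 1), (a k).eval l • T (k + 1) := by
    rw [hatZ, hrange]
    refine Finset.sum_congr rfl fun k hk => ?_
    have hk := Finset.mem_range.1 hk
    rw [eT _ (by omega)]
  rw [hx, hy, hz]
  exact key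

end Main

end IsingChain

theorem mainTheorem4 (n : ℕ) (hn : 3 ≤ n) (l : ℝ) (hl : (IsingChain.a (n - 1)).IsRoot l) :
    ∃ I : LieIdeal ℝ (IsingChain.dynamicalLieAlgebra n),
      I.toSubmodule.map (IsingChain.dynamicalLieAlgebra n).toSubmodule.subtype =
        Submodule.span ℝ
          {IsingChain.hatX n l, IsingChain.hatY n l, IsingChain.hatZ n l} :=
  IsingChain.exists_lieIdeal_hat n hn l hl
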